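/- Fix $d$. Let $M_n=M_n(\mathbb C)$, and consider subsets $\mathcal S$ of $\bigsqcup_{n\ge 1} M_n^d$, with levels $\mathcal S_n=\mathcal S\cap M_n^d$. Linear maps, direct sums, and products $V^*XV$ are applied to tuples coordinatewise, and tuples $X,Y\in M_n^d$ are unitarily equivalent if $Y=U^*XU$ for some unitary $U\in M_n$ (tuples of different sizes are never unitarily equivalent). $\mathbb C^d$ is identified with $M_1^d$. The set $\mathcal S$ is matrix convex if it is closed under direct sums and under all unital completely positive maps $M_m\to M_k$, and closed if every level $\mathcal S_n$ is closed. The closed matrix convex hull of a set is the smallest closed matrix convex set containing it. A matrix convex combination of points $X^{(i)}\in\mathcal S_{n_i}$, $1\le i\le k$, is a sum $\sum_{i=1}^k V_i^*X^{(i)}V_i\in M_n^d$ with $V_i\in M_{n_i,n}$ and $\sum_{i=1}^k V_i^*V_i=I_n$; it is proper if $\operatorname{rank}V_i=n_i$ for all $i$, and weakly proper if $V_i\ne 0$ for all $i$. For $X\in\mathcal S$: - $X$ is a matrix extreme point of $\mathcal S$, $X\in\mathrm{MEP}(\mathcal S)$, if whenever $X$ is a proper matrix convex combination of points $X^{(i)}\in\mathcal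 S$, every $X^{(i)}$ is unitarily equivalent to $X$; - $X$ is an absolute extreme point of $\mathcal S$, $X\in\mathrm{AEP}(\mathcal S)$, if whenever $X$ is a weakly proper matrix convex combination of points $X^{(i)}\in\mathcal S$, every $X^{(i)}$ is unitarily equivalent to $X$ or to $X\oplus Z_i$ for some $Z_i\in\mathcal S$; - $X$ is a crucial matrix extreme point of $\mathcal S$ if $X$ does not belong to the closed matrix convex hull of the set of all matrix extreme points of $\mathcal S$ that are not unitarily equivalent to $X$. For $K\subset\mathbb C^d$, let $\mathcal W^{\min}(K)$ be the set of all $M\in\bigsqcup_{n\ge1}M_n^d$ that have a normal dilation with joint spectrum in $K$: there are a complex Hilbert space $H$, an isometry $W:\mathbb C^n\to H$ and a tuple $N=(N_1,\dots,N_d)$ of commuting normal bounded operators on $H$ such that $M_i=W^*N_iW$ for all $i$ and $(\chi(N_1),\dots,\chi(N_d))\in K$ for every character $\chi$ of the unital C*-algebra generated by $N$. **Proposition.** Let $K\subset\mathbb C^d$ be compact and convex. Then $$\mathrm{ext}(K)=\mathrm{MEP}(\mathcal W^{\min}(K))=\mathrm{AEP}(\mathcal W^{\min}(K)),$$ where $\mathrm{ext}(K)$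 is the set of extreme points of $K$. Moreover, $$\{\lambda\in\mathrm{ext}(K):\lambda\text{ is isolated in }\mathrm{ext}(K)\}=\{X\in\mathcal W^{\min}(K): X\text{ is a crucial matrix extreme point of }\mathcal W^{\min}(K)\}.$$ -/

import Mathlib

namespace MatrixConvex

open scoped Matrix ComplexOrder

/-- The space `M_n(ℂ)^d` of `d`-tuples of complex `n × n` matrices. -/
abbrev MatTuple (d n : ℕ) : Type := Fin d → Matrix (Fin n) (Fin n) ℂ

/-- The disjoint union of the spaces `M_n(ℂ)^d` over all `n ≥ 1`.
A point `X` has size `X.1` and underlying tuple `X.2`; a free set is a subset of this type. -/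
abbrev FreeSpace (d : ℕ) : Type := Σ n : ℕ+, MatTuple d n

/-- The `n`th level of a free set. -/
def level {d : ℕ} (S : Set (FreeSpace d)) (n : ℕ+) : Set (MatTuple d n) :=
  {X | (⟨n, X⟩ : FreeSpace d) ∈ S}

/-- The identification of `ℂ^d` with the first level `M_1(ℂ)^d`. -/
def ofPoint {d : ℕ} (x : Fin d → ℂ) : FreeSpace d :=
  ⟨1, fun i => Matrix.of fun _ _ => x i⟩

/-- The direct sum `X ⊕ Y`, taken coordinatewise as block diagonal matrices. -/
def directSum {d : ℕ} (X Y : FreeSpace d) : FreeSpace d :=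
  ⟨X.1 + Y.1, fun i =>
    Matrix.reindex finSumFinEquiv finSumFinEquiv (Matrix.fromBlocks (X.2 i) 0 0 (Y.2 i))⟩

/-- Unitary equivalence of matrix tuples. A rectangular `U` with `U* U = 1` and `U U* = 1`
is necessarily square, so that equivalent tuples have the same size. -/
def UnitarilyEquivalent {d : ℕ} (X Y : FreeSpace d) : Prop :=
  ∃ U : Matrix (Fin X.1) (Fin Y.1) ℂ,
    Uᴴ * U = 1 ∧ U * Uᴴ = 1 ∧ ∀ i, Y.2 i = Uᴴ * X.2 i * U

/-- Unital completely positive maps `M_m → M_k`: unital linear maps all of whose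
amplifications `M_r(M_m) → M_r(M_k)` preserve positive semidefiniteness. -/
structure IsUCP {m k : ℕ}
    (φ : Matrix (Fin m) (Fin m) ℂ →ₗ[ℂ] Matrix (Fin k) (Fin k) ℂ) : Prop where
  map_one : φ 1 = 1
  map_posSemidef : ∀ (r : ℕ) (A : Matrix (Fin r) (Fin r) (Matrix (Fin m) (Fin m) ℂ)),
    (Matrix.comp (Fin r) (Fin r) (Fin m) (Fin m) ℂ A).PosSemidef →
      (Matrix.comp (Fin r) (Fin r) (Fin k) (Fin k) ℂ (A.map φ)).PosSemidef

/-- A free set is matrix convex if it is closed under direct sums and under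
(coordinatewise application of) unital completely positive maps. -/
structure IsMatrixConvex {d : ℕ} (S : Set (FreeSpace d)) : Prop where
  directSum_mem : ∀ X ∈ S, ∀ Y ∈ S, directSum X Y ∈ S
  ucp_mem : ∀ X ∈ S, ∀ (k : ℕ+)
    (φ : Matrix (Fin X.1) (Fin X.1) ℂ →ₗ[ℂ] Matrix (Fin k) (Fin k) ℂ),
    IsUCP φ → (⟨k, fun i => φ (X.2 i)⟩ : FreeSpace d) ∈ S

/-- A free set is closed if each of its levels is closed. -/
def IsLevelClosed {d : ℕ} (S : Set (FreeSpace d)) : Prop :=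
  ∀ n : ℕ+, IsClosed (level S n)

/-- The closed matrix convex hull: the smallest closed matrix convex set containing `C`. -/
def closedMatrixConvexHull {d : ℕ} (C : Set (FreeSpace d)) : Set (FreeSpace d) :=
  ⋂₀ {S | C ⊆ S ∧ IsMatrixConvex S ∧ IsLevelClosed S}

/-- `X = ∑ i, V_i* Y_i V_i` is a matrix convex combination of points `Y_i` of `S`. -/
structure IsMatrixConvexCombination {d : ℕ} (S : Set (FreeSpace d)) (X : FreeSpace d) {k : ℕ}
    (Y : Fin k → FreeSpace d) (V : ∀ i, Matrix (Fin (Y i).1) (Fin X.1) ℂ) : Prop where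
  mem : ∀ i, Y i ∈ S
  sum_eq_one : ∑ i, (V i)ᴴ * V i = 1
  eq_sum : ∀ j, X.2 j = ∑ i, (V i)ᴴ * (Y i).2 j * V i

/-- The set of matrix extreme points: in every proper matrix convex combination
(`rank V_i = n_i`, the size of `Y_i`) all `Y_i` are unitarily equivalent to `X`. -/
def MEP {d : ℕ} (S : Set (FreeSpace d)) : Set (FreeSpace d) :=
  {X | X ∈ S ∧ ∀ (k : ℕ) (Y : Fin k → FreeSpace d)
    (V : ∀ i, Matrix (Fin (Y i).1) (Fin X.1) ℂ),
    IsMatrixConvexCombination S X Y V → (∀ i, (V i).rank = (Y i).1) →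
      ∀ i, UnitarilyEquivalent (Y i) X}

/-- The set of absolute extreme points: in every weakly proper matrix convex combination
(`V_i ≠ 0`) each `Y_i` is unitarily equivalent to `X` or to some `X ⊕ Z` with `Z ∈ S`. -/
def AEP {d : ℕ} (S : Set (FreeSpace d)) : Set (FreeSpace d) :=
  {X | X ∈ S ∧ ∀ (k : ℕ) (Y : Fin k → FreeSpace d)
    (V : ∀ i, Matrix (Fin (Y i).1) (Fin X.1) ℂ),
    IsMatrixConvexCombination S X Y V → (∀ i, V i ≠ 0) →
      ∀ i, UnitarilyEquivalent (Y i) X ∨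
        ∃ Z ∈ S, UnitarilyEquivalent (Y i) (directSum X Z)}

/-- The set of crucial matrix extreme points: points `X ∈ S` outside the closed matrix convex
hull of the matrix extreme points that are not unitarily equivalent to `X`. -/
def crucialMEP {d : ℕ} (S : Set (FreeSpace d)) : Set (FreeSpace d) :=
  {X | X ∈ S ∧ X ∉ closedMatrixConvexHull {M | M ∈ MEP S ∧ ¬ UnitarilyEquivalent M X}}

/-- A normal tuple consists of commuting normal operators. -/
structure IsNormalTuple {d : ℕ} {H : Type*} [NormedAddCommGroup H] [InnerProductSpace ℂ H]
    [CompleteSpace H] (N : Fin d → H →L[ℂ] H) : Prop where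
  normal : ∀ i, IsStarNormal (N i)
  commute : ∀ i j, Commute (N i) (N j)

/-- The unital C*-algebra generated by a tuple of bounded operators. -/
noncomputable def unitalCStar {d : ℕ} {H : Type*} [NormedAddCommGroup H]
    [InnerProductSpace ℂ H] [CompleteSpace H] (N : Fin d → H →L[ℂ] H) :
    StarSubalgebra ℂ (H →L[ℂ] H) :=
  (StarAlgebra.adjoin ℂ (Set.range N)).topologicalClosure

/-- Each operator of a tuple lies in the C*-algebra which the tuple generates. -/
theorem mem_unitalCStar {d : ℕ} {H : Type*} [NormedAddCommGroup H]
    [InnerProductSpace ℂ H] [CompleteSpace H] (N : Fin d → H →L[ℂ] H) (i : Fin d) :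
    N i ∈ unitalCStar N :=
  StarSubalgebra.le_topologicalClosure _ (StarAlgebra.subset_adjoin ℂ _ ⟨i, rfl⟩)

/-- The joint spectrum of a normal tuple `N`: all points `(χ(N_1), …, χ(N_d))`, where `χ` is a
character of the (commutative) unital C*-algebra generated by `N`. -/
def jointSpectrum {d : ℕ} {H : Type*} [NormedAddCommGroup H] [InnerProductSpace ℂ H]
    [CompleteSpace H] (N : Fin d → H →L[ℂ] H) : Set (Fin d → ℂ) :=
  Set.range fun (χ : unitalCStar N →⋆ₐ[ℂ] ℂ) (i : Fin d) => χ ⟨N i, mem_unitalCStar N i⟩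

/-- `Wmin K`: the matrix tuples `M` that have a normal dilation with joint spectrum in `K`,
that is, `M_i = W* N_i W` for an isometry `W` into a complex Hilbert space `H` and a normal tuple
`N` on `H` with joint spectrum in `K`. -/
def Wmin {d : ℕ} (K : Set (Fin d → ℂ)) : Set (FreeSpace d) :=
  {M | ∃ (H : Type) (_ : NormedAddCommGroup H) (_ : InnerProductSpace ℂ H) (_ : CompleteSpace H)
    (N : Fin d → H →L[ℂ] H) (W : EuclideanSpace ℂ (Fin M.1) →ₗᵢ[ℂ] H),
    IsNormalTuple N ∧ jointSpectrum N ⊆ K ∧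
      ∀ i, Matrix.toEuclideanCLM (𝕜 := ℂ) (M.2 i) =
        (ContinuousLinearMap.adjoint W.toContinuousLinearMap) ∘L N i ∘L
          W.toContinuousLinearMap}

/-- The set of isolated extreme points of `K`: extreme points `x` of `K` which have a
neighbourhood containing no other extreme point of `K`. -/
def isolatedExtremePoints {d : ℕ} (K : Set (Fin d → ℂ)) : Set (Fin d → ℂ) :=
  {x | x ∈ K.extremePoints ℝ ∧ ∃ U : Set (Fin d → ℂ), IsOpen U ∧ U ∩ K.extremePoints ℝ = {x}}

end MatrixConvex

namespace MatrixConvex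

open scoped Matrix ComplexOrder Kronecker

/-! Everything rests on `exists_decomposition_of_mem_Wmin`: each `X` in `Wmin K` is a finite sum
`X_i = ∑ x_j(i) v_j v_j*` with `x_j ∈ K` and `∑ v_j v_j* = 1`. A normal dilation yields a positive
unital map on some `C(Ω)`; partitions of unity give approximations of this form; after division by
the size these lie in the convex hull of a compact set, which is compact in finite dimension, so the
limit has the same form.

The decomposition is a proper matrix convex combination of level-one points, so a matrix extreme
point is a single point of `K`, necessarily extreme. Conversely, let an extreme point `x` be `∑ V_i*
Y_i V_i`, where `V_i` is a column `u_i`. Decomposing each `Y_i` writes `x` as a scalar convex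
combination; every point of nonzero weight equals `x`, so `u_i` is a reducing joint eigenvector of
`Y_i` and `x` splits off (`ofPoint_mem_AEP`). A size count gives `AEP ⊆ MEP`.

For crucial points, a closed matrix convex set containing the extreme points contains `Wmin K`
(`Wmin_subset`). An isolated extreme point is separated from the others by Milman's converse and
Hahn–Banach, and the separating half-space extends to all matrix levels (`exists_halfSpace`). -/

/-! ### Compactness of convex hulls -/

theorem _root_.IsCompact.convexHull_of_finiteDimensional {E : Type*} [AddCommGroup E] [Module ℝ E]
    [TopologicalSpace E] [ContinuousAdd E] [ContinuousSMul ℝ E] [FiniteDimensional ℝ E] {s : Set E}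
    (hs : IsCompact s) : IsCompact (convexHull ℝ s) := by
  -- Carathéodory: `finrank + 1` points suffice, so the hull is a finite union of continuous images
  -- of compact sets.
  have key : convexHull ℝ s = ⋃ k ∈ Finset.range (Module.finrank ℝ E + 2),
      (fun p : (Fin k → ℝ) × (Fin k → E) => ∑ i, p.1 i • p.2 i) ''
        (stdSimplex ℝ (Fin k) ×ˢ Set.univ.pi fun _ => s) := by
    apply Set.Subset.antisymm
    · intro x hx
      obtain ⟨ι, _, z, w, hz, haff, hw, hw1, hx⟩ := eq_pos_convex_span_of_mem_convexHull hx
      have hcard : Fintype.card ι ≤ Module.finrank ℝ E + 1 :=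
        haff.card_le_finrank_succ.trans (by gcongr; exact Submodule.finrank_le _)
      let e := (Fintype.equivFin ι).symm
      simp only [Set.mem_iUnion]
      refine ⟨Fintype.card ι, Finset.mem_range.2 (by omega), ⟨w ∘ e, z ∘ e⟩, ⟨⟨?_, ?_⟩, ?_⟩, ?_⟩
      · exact fun i => (hw _).le
      · rw [← hw1]; exact e.sum_comp w
      · exact fun i _ => hz ⟨e i, rfl⟩
      · rw [← hx]; exact e.sum_comp fun i => w i • z i
    · simp only [Set.iUnion_subset_iff]
      rintro k - _ ⟨⟨w, z⟩, ⟨⟨h0, h1⟩, hz⟩, rfl⟩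
      exact (convex_convexHull ℝ s).sum_mem (fun i _ => h0 i) h1
        fun i _ => subset_convexHull ℝ s (hz i trivial)
  rw [key]
  refine Finset.isCompact_biUnion _ fun k _ => ?_
  refine ((isCompact_stdSimplex ℝ (Fin k)).prod (isCompact_univ_pi fun _ => hs)).image ?_
  fun_prop

/-! ### Functional calculus for normal tuples -/

/-- By Fuglede's theorem each `N i` also commutes with the adjoint of each `N j`; commutativity then
passes to the closure. -/
theorem mul_comm_unitalCStar {d : ℕ} {H : Type*} [NormedAddCommGroup H]
    [InnerProductSpace ℂ H] [CompleteSpace H] {N : Fin d → H →L[ℂ] H} (hN : IsNormalTuple N)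
    (a b : unitalCStar N) : a * b = b * a := by
  have h := StarAlgebra.isMulCommutative_adjoin ℂ (s := Set.range N)
    (by rintro _ ⟨i, rfl⟩ _ ⟨j, rfl⟩; exact hN.commute i j)
    (by
      rintro _ ⟨i, rfl⟩ _ ⟨j, rfl⟩
      exact (hN.normal j).commute_star_right (hN.commute i j))
  exact (StarSubalgebra.commRingTopologicalClosure (StarAlgebra.adjoin ℂ (Set.range N))
    fun x y => h.is_comm.comm x y).mul_comm a b

/-- The commutative C*-algebra generated by a normal tuple. -/
noncomputable abbrev commCStarAlgebra_unitalCStar {d : ℕ} {H : Type*} [NormedAddCommGroup H]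
    [InnerProductSpace ℂ H] [CompleteSpace H] {N : Fin d → H →L[ℂ] H} (hN : IsNormalTuple N) :
    CommCStarAlgebra (unitalCStar N) :=
  haveI : IsClosed (unitalCStar N : Set (H →L[ℂ] H)) := StarSubalgebra.isClosed_topologicalClosure _
  { StarSubalgebra.cstarAlgebra (unitalCStar N) with
    mul_comm := mul_comm_unitalCStar hN }

/-- Functional calculus for normal tuples: the coordinates of the joint spectrum are
represented by the operators of the tuple. -/
theorem exists_starAlgHom_of_isNormalTuple {d : ℕ} {H : Type} [NormedAddCommGroup H]
    [InnerProductSpace ℂ H] [CompleteSpace H] {N : Fin d → H →L[ℂ] H} (hN : IsNormalTuple N) :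
    ∃ (Ω : Type) (_ : TopologicalSpace Ω) (_ : CompactSpace Ω) (g : Fin d → C(Ω, ℂ))
      (π : C(Ω, ℂ) →⋆ₐ[ℂ] (H →L[ℂ] H)),
      (∀ ω, (fun i => g i ω) ∈ jointSpectrum N) ∧ (∀ f, ‖π f‖ ≤ ‖f‖) ∧ ∀ i, π (g i) = N i := by
  let _ := commCStarAlgebra_unitalCStar hN
  let G := gelfandStarTransform (unitalCStar N)
  -- The inverse Gelfand transform. Its spectrum consists of characters, so the coordinates take
  -- values in the joint spectrum by definition.
  let π : C(WeakDual.characterSpace ℂ (unitalCStar N), ℂ) →⋆ₐ[ℂ] (H →L[ℂ] H) :=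
    (unitalCStar N).subtype.comp (G.symm : _ →⋆ₐ[ℂ] _)
  refine ⟨WeakDual.characterSpace ℂ (unitalCStar N), inferInstance, inferInstance,
    fun i => G ⟨N i, mem_unitalCStar N i⟩, π, fun ω => ?_, fun f => ?_, fun i => ?_⟩
  · exact ⟨{ WeakDual.CharacterSpace.toAlgHom ω with map_star' := fun a => map_star ω a }, rfl⟩
  · exact NonUnitalStarAlgHom.norm_apply_le π f
  · change ((G.symm (G ⟨N i, mem_unitalCStar N i⟩) : unitalCStar N) : H →L[ℂ] H) = N i
    rw [G.symm_apply_apply]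

/-- The map is `f ↦ W* π(f) W`, written entrywise. It retains all that is needed of the dilation and
removes the Hilbert space. -/
theorem exists_positive_map_of_mem_Wmin {d : ℕ} {K : Set (Fin d → ℂ)} {X : FreeSpace d}
    (hX : X ∈ Wmin K) :
    ∃ (Ω : Type) (_ : TopologicalSpace Ω) (_ : CompactSpace Ω) (g : Fin d → C(Ω, ℂ))
      (Φ : C(Ω, ℂ) →ₗ[ℂ] Matrix (Fin X.1) (Fin X.1) ℂ),
      (∀ ω, (fun i => g i ω) ∈ K) ∧ Φ 1 = 1 ∧ (∀ f, (Φ (star f * f)).PosSemidef) ∧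
      (∀ f a b, ‖Φ f a b‖ ≤ ‖f‖) ∧ ∀ i, Φ (g i) = X.2 i := by
  obtain ⟨H, _, _, _, N, W, hN, hNK, hW⟩ := hX
  obtain ⟨Ω, _, _, g, π, hg, hπ, hπg⟩ := exists_starAlgHom_of_isNormalTuple hN
  let Φ : C(Ω, ℂ) →ₗ[ℂ] Matrix (Fin X.1) (Fin X.1) ℂ :=
    { toFun f := Matrix.of fun a b =>
        inner ℂ (W (EuclideanSpace.single a 1)) (π f (W (EuclideanSpace.single b 1)))
      map_add' f f' := by ext; simp
      map_smul' c f := by ext; simp }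
  have hΦ (f a b) : Φ f a b =
    inner ℂ (W (EuclideanSpace.single a 1)) (π f (W (EuclideanSpace.single b 1))) := rfl
  have hΦq (f) (x : Fin X.1 → ℂ) : star x ⬝ᵥ (Φ f *ᵥ x) =
      inner ℂ (W (WithLp.toLp 2 x)) (π f (W (WithLp.toLp 2 x))) := by
    have hx : WithLp.toLp 2 x = ∑ a, x a • EuclideanSpace.single a (1 : ℂ) := by
      ext b; simp [Pi.single_apply]
    rw [hx]
    simp only [map_sum, map_smul, sum_inner, inner_sum, inner_smul_left, inner_smul_right,
      dotProduct, Matrix.mulVec, Finset.mul_sum, hΦ]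
    rw [Finset.sum_comm]
    refine Finset.sum_congr rfl fun a _ => Finset.sum_congr rfl fun b _ => ?_
    simp only [Pi.star_apply, RCLike.star_def]
    ring
  refine ⟨Ω, ‹_›, ‹_›, g, Φ, fun ω => hNK (hg ω), ?_, fun f => ?_, fun f a b => ?_, fun i => ?_⟩
  · ext a b
    simp [hΦ, EuclideanSpace.inner_single_left, Matrix.one_apply]
  · have h0 (x : Fin X.1 → ℂ) : 0 ≤ star x ⬝ᵥ (Φ (star f * f) *ᵥ x) := by
      rw [hΦq, map_mul, map_star, mul_apply_eq_comp,
        ContinuousLinearMap.star_eq_adjoint, ContinuousLinearMap.adjoint_inner_right]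
      rw [inner_self_eq_norm_sq_to_K]
      positivity
    refine Matrix.PosSemidef.of_dotProduct_mulVec_nonneg ?_ h0
    ext a b
    rw [Matrix.conjTranspose_apply, hΦ, hΦ, map_mul, map_star, mul_apply_eq_comp,
      ContinuousLinearMap.star_eq_adjoint, mul_apply_eq_comp,
      ContinuousLinearMap.adjoint_inner_right, ContinuousLinearMap.adjoint_inner_right]
    exact inner_conj_symm _ _
  · rw [hΦ]
    refine (norm_inner_le_norm _ _).trans ?_
    simp only [LinearIsometry.norm_map, PiLp.norm_single, norm_one, one_mul]
    refine ((π f).le_opNorm _).trans ?_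
    simpa using hπ f
  · ext a b
    have := congr(inner ℂ (EuclideanSpace.single a (1 : ℂ)) ($(hW i) (EuclideanSpace.single b 1)))
    rw [ContinuousLinearMap.comp_apply, ContinuousLinearMap.adjoint_inner_right] at this
    rw [hΦ, hπg]
    simpa [EuclideanSpace.inner_single_left, Matrix.ofLp_toEuclideanCLM] using this.symm

/-! ### Rank one decompositions -/

/-- The pairs `(P, x P)` of a rank one projection `P` and its multiples by a point `x` of `K`. -/
def rankOneData {d : ℕ} (n : ℕ) (K : Set (Fin d → ℂ)) :
    Set (Matrix (Fin n) (Fin n) ℂ × MatTuple d n) :=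
  (fun p : (Fin n → ℂ) × (Fin d → ℂ) =>
    (Matrix.vecMulVec p.1 (star p.1), fun i => p.2 i • Matrix.vecMulVec p.1 (star p.1))) ''
    ({v | ∑ a, ‖v a‖ ^ 2 = 1} ×ˢ K)

theorem isCompact_rankOneData {d : ℕ} (n : ℕ) {K : Set (Fin d → ℂ)} (hK : IsCompact K) :
    IsCompact (rankOneData n K) := by
  refine (IsCompact.prod ?_ hK).image ?_
  · refine (isCompact_closedBall (0 : Fin n → ℂ) 1).of_isClosed_subset
      (isClosed_eq (by fun_prop) continuous_const) fun v hv => ?_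
    rw [mem_closedBall_zero_iff, pi_norm_le_iff_of_nonneg zero_le_one]
    intro a
    have : ‖v a‖ ^ 2 ≤ 1 :=
      (Finset.single_le_sum (f := fun a => ‖v a‖ ^ 2) (fun _ _ => by positivity)
        (Finset.mem_univ a)).trans hv.le
    exact (sq_le_one_iff₀ (norm_nonneg _)).1 this
  · refine Continuous.prodMk ?_ (continuous_pi fun i => ?_) <;>
    · refine continuous_matrix fun a b => ?_
      simp only [Matrix.smul_apply, Matrix.vecMulVec_apply, Pi.star_apply]
      fun_prop

/-- Every rank one matrix is a nonnegative multiple of a rank one projection. -/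
theorem exists_unit_vecMulVec {n : ℕ} (hn : 0 < n) (v : Fin n → ℂ) :
    ∃ u : Fin n → ℂ, ∑ a, ‖u a‖ ^ 2 = 1 ∧
      Matrix.vecMulVec v (star v) = (∑ a, ‖v a‖ ^ 2) • Matrix.vecMulVec u (star u) := by
  set t := ∑ a, ‖v a‖ ^ 2 with ht
  have ht0 : 0 ≤ t := Finset.sum_nonneg fun _ _ => by positivity
  rcases ht0.eq_or_lt with h | h
  -- Here `v = 0`, so any unit vector serves; `hn` supplies a coordinate.
  · refine ⟨Pi.single ⟨0, hn⟩ 1, ?_, ?_⟩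
    · rw [Finset.sum_eq_single ⟨0, hn⟩] <;> simp +contextual
    · have hv : v = 0 := by
        ext a
        have := (Finset.sum_eq_zero_iff_of_nonneg (fun _ _ => by positivity)).1 h.symm a
          (Finset.mem_univ a)
        simpa using this
      rw [← h, hv]
      simp
  · refine ⟨((Real.sqrt t)⁻¹ : ℂ) • v, ?_, ?_⟩
    · simp only [Pi.smul_apply, norm_smul, mul_pow, ← Finset.mul_sum, ← ht]
      rw [norm_inv, Complex.norm_real, Real.norm_eq_abs, inv_pow, sq_abs, Real.sq_sqrt ht0,
        inv_mul_cancel₀ h.ne']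
    · ext a b
      have h2 : (Real.sqrt t : ℂ) * Real.sqrt t = t := by
        rw [← Complex.ofReal_mul, Real.mul_self_sqrt ht0]
      have h3 : (Real.sqrt t : ℂ) ≠ 0 := by
        exact_mod_cast (Real.sqrt_pos.2 h).ne'
      simp only [Matrix.vecMulVec_apply, Matrix.smul_apply, Pi.star_apply, Pi.smul_apply,
        smul_eq_mul, star_mul', Complex.real_smul, RCLike.star_def, map_inv₀, Complex.conj_ofReal]
      rw [← h2]
      field_simp

theorem sum_norm_sq_eq_trace {n : ℕ} (v : Fin n → ℂ) :
    ((∑ a, ‖v a‖ ^ 2 : ℝ) : ℂ) = (Matrix.vecMulVec v (star v)).trace := by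
  simp [Matrix.trace, Matrix.vecMulVec_apply, Complex.mul_conj, Complex.normSq_eq_norm_sq]

/-- A sum of rank one matrices with weights in `K`, normalised to have trace one, lies in the
convex hull of the rank one projections with weights in `K`. -/
theorem smul_sum_mem_convexHull_rankOneData {d n : ℕ} (hn : 0 < n) {K : Set (Fin d → ℂ)}
    {ι : Type*} [Fintype ι] (v : ι → Fin n → ℂ) (x : ι → Fin d → ℂ) (hx : ∀ j, x j ∈ K)
    (hv : ∑ j, Matrix.vecMulVec (v j) (star (v j)) = 1) :
    (n : ℝ)⁻¹ • ((1, fun i => ∑ j, x j i • Matrix.vecMulVec (v j) (star (v j))) :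
      Matrix (Fin n) (Fin n) ℂ × MatTuple d n) ∈ convexHull ℝ (rankOneData n K) := by
  choose u hu huv using fun j => exists_unit_vecMulVec hn (v j)
  have hn' : (n : ℝ) ≠ 0 := by exact_mod_cast hn.ne'
  -- The trace of `hv` shows that the weights add up to `n`, hence the factor `n⁻¹`.
  have hsum : ∑ j, ∑ a, ‖v j a‖ ^ 2 = n := by
    have : ((∑ j, ∑ a, ‖v j a‖ ^ 2 : ℝ) : ℂ) = n := by
      rw [Complex.ofReal_sum]
      simp_rw [sum_norm_sq_eq_trace]
      rw [← Matrix.trace_sum, hv, Matrix.trace_one, Fintype.card_fin]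
    exact_mod_cast this
  have := (convex_convexHull ℝ (rankOneData n K)).sum_mem (t := Finset.univ)
    (w := fun j => (n : ℝ)⁻¹ * ∑ a, ‖v j a‖ ^ 2)
    (z := fun j => (Matrix.vecMulVec (u j) (star (u j)),
      fun i => x j i • Matrix.vecMulVec (u j) (star (u j))))
    (fun j _ => by positivity) (by rw [← Finset.mul_sum, hsum, inv_mul_cancel₀ hn'])
    (fun j _ => subset_convexHull ℝ _ ⟨(u j, x j), ⟨hu j, hx j⟩, rfl⟩)
  convert this using 1
  simp_rw [mul_smul, ← Finset.smul_sum]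
  congr 1
  refine Prod.ext ?_ ?_
  · rw [Prod.fst_sum, ← hv]
    exact Finset.sum_congr rfl fun j _ => huv j
  · funext i
    rw [Prod.snd_sum, Finset.sum_apply]
    refine Finset.sum_congr rfl fun j _ => ?_
    rw [huv j, smul_comm]
    rfl

/-- A finite partition of unity by continuous functions, subordinate to small balls in `K`. -/
theorem exists_partition_of_unity {Ω : Type*} [TopologicalSpace Ω] {d : ℕ} {K : Set (Fin d → ℂ)}
    (hK : IsCompact K) {g : Ω → Fin d → ℂ} (hg : Continuous g) (hgK : ∀ ω, g ω ∈ K)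
    {ε : ℝ} (hε : 0 < ε) :
    ∃ (t : Finset (Fin d → ℂ)) (ρ : (Fin d → ℂ) → C(Ω, ℝ)), (∀ x ∈ t, x ∈ K) ∧ (∀ x ω, 0 ≤ ρ x ω) ∧
      (∀ ω, ∑ x ∈ t, ρ x ω = 1) ∧ ∀ x ω, ρ x ω * dist (g ω) x ≤ ρ x ω * ε := by
  obtain ⟨s, hsK, hsfin, hs⟩ := hK.finite_cover_balls hε
  -- Hat functions, positive exactly where `g` is closer than `ε` to the centre. The balls cover
  -- `K`, so the sum is positive and can be divided out.
  let h : (Fin d → ℂ) → Ω → ℝ := fun x ω => max 0 (ε - dist (g ω) x)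
  have hh (x ω) : 0 ≤ h x ω := le_max_left _ _
  have hpos (ω) : 0 < ∑ x ∈ hsfin.toFinset, h x ω := by
    obtain ⟨x, hx, hx'⟩ := Set.mem_iUnion₂.1 (hs (hgK ω))
    refine Finset.sum_pos' (fun _ _ => hh _ _) ⟨x, hsfin.mem_toFinset.2 hx, ?_⟩
    exact lt_max_of_lt_right (sub_pos.2 hx')
  have hcont (x) : Continuous (h x) := by fun_prop
  refine ⟨hsfin.toFinset, fun x => ⟨fun ω => h x ω / ∑ y ∈ hsfin.toFinset, h y ω, ?_⟩,
    fun x hx => hsK (hsfin.mem_toFinset.1 hx), fun x ω => div_nonneg (hh _ _) (hpos ω).le,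
    fun ω => ?_, fun x ω => ?_⟩
  · exact (hcont x).div₀ (continuous_finsetSum _ fun y _ => hcont y) fun ω => (hpos ω).ne'
  · simp only [ContinuousMap.coe_mk]
    rw [← Finset.sum_div, div_self (hpos ω).ne']
  · simp only [ContinuousMap.coe_mk]
    rcases le_or_gt ε (dist (g ω) x) with hd | hd
    · have : h x ω = 0 := max_eq_left (by linarith)
      simp [this]
    · exact mul_le_mul_of_nonneg_left hd.le (div_nonneg (hh _ _) (hpos ω).le)

/-- The function `∑ x_i ρ_x` is uniformly within `ε` of `g i`, and each `Φ ρ_x` is positive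
semidefinite, hence a sum of rank one matrices. -/
theorem exists_approx_of_mem_Wmin {d : ℕ} {K : Set (Fin d → ℂ)} (hK : IsCompact K)
    {X : FreeSpace d} (hX : X ∈ Wmin K) {ε : ℝ} (hε : 0 < ε) :
    ∃ Y : MatTuple d X.1,
      ((X.1 : ℕ) : ℝ)⁻¹ • ((1, Y) : Matrix (Fin X.1) (Fin X.1) ℂ × MatTuple d X.1) ∈
        convexHull ℝ (rankOneData X.1 K) ∧ ∀ i a b, ‖Y i a b - X.2 i a b‖ ≤ ε := by
  obtain ⟨Ω, _, _, g, Φ, hgK, hΦ1, hΦpos, hΦn, hΦg⟩ := exists_positive_map_of_mem_Wmin hX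
  obtain ⟨t, ρ, htK, hρ0, hρ1, hρ⟩ := exists_partition_of_unity (g := fun ω i => g i ω) hK
    (by fun_prop) hgK hε
  let r : (Fin d → ℂ) → C(Ω, ℂ) := fun x => ⟨fun ω => (ρ x ω : ℂ), by fun_prop⟩
  have hr (x) : (Φ (r x)).PosSemidef := by
    have := hΦpos ⟨fun ω => (Real.sqrt (ρ x ω) : ℂ), by fun_prop⟩
    convert this using 2
    ext ω
    simp [r, ← Complex.ofReal_mul, Real.mul_self_sqrt (hρ0 x ω)]
  have hr1 : ∑ x ∈ t, r x = 1 := by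
    ext ω
    simp [r, ← Complex.ofReal_sum, hρ1]
  choose m v hv using fun x => Matrix.posSemidef_iff_eq_sum_vecMulVec.1 (hr x)
  refine ⟨fun i => Φ (∑ x ∈ t, x i • r x), ?_, fun i a b => ?_⟩
  · have := smul_sum_mem_convexHull_rankOneData X.1.pos (K := K) (ι := Σ x : t, Fin (m x))
      (fun p => v p.1 p.2) (fun p => (p.1 : Fin d → ℂ)) (fun p => htK p.1 p.1.2) (by
        rw [Fintype.sum_sigma]
        simp_rw [← hv]
        rw [Finset.sum_coe_sort t fun x => Φ (r x), ← map_sum, hr1, hΦ1])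
    convert this using 5 with i
    rw [Fintype.sum_sigma]
    simp_rw [← Finset.smul_sum, ← hv]
    rw [Finset.sum_coe_sort t fun x => x i • Φ (r x), map_sum]
    simp_rw [map_smul]
  · rw [← hΦg, ← Matrix.sub_apply, ← map_sub]
    refine (hΦn _ a b).trans ((ContinuousMap.norm_le _ hε.le).2 fun ω => ?_)
    have h1 : (∑ x ∈ t, x i • r x - g i) ω = ∑ x ∈ t, (ρ x ω : ℂ) * (x i - g i ω) := by
      have h2 := congr((($(hρ1 ω) : ℝ) : ℂ) * g i ω)
      push_cast at h2
      simp only [mul_sub, Finset.sum_sub_distrib, ← Finset.sum_mul, h2, one_mul]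
      simp [r, ContinuousMap.sum_apply, mul_comm]
    rw [h1]
    calc _ ≤ ∑ x ∈ t, ρ x ω * ε := (norm_sum_le _ _).trans (Finset.sum_le_sum fun x _ => by
            rw [norm_mul, Complex.norm_real, Real.norm_of_nonneg (hρ0 x ω)]
            refine le_trans ?_ (hρ x ω)
            refine mul_le_mul_of_nonneg_left ?_ (hρ0 x ω)
            rw [← dist_eq_norm, dist_comm]
            exact dist_le_pi_dist (fun i => g i ω) x i)
      _ = ε := by rw [← Finset.sum_mul, hρ1, one_mul]

/-- The hull is closed, so approximations can be passed to the limit. The first component `1` makes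
the resolution of the identity survive. -/
theorem mem_convexHull_rankOneData_of_mem_Wmin {d : ℕ} {K : Set (Fin d → ℂ)} (hK : IsCompact K)
    {X : FreeSpace d} (hX : X ∈ Wmin K) :
    ((X.1 : ℕ) : ℝ)⁻¹ • ((1, X.2) : Matrix (Fin X.1) (Fin X.1) ℂ × MatTuple d X.1) ∈
      convexHull ℝ (rankOneData X.1 K) := by
  choose Y hY hYX using fun m : ℕ =>
    exists_approx_of_mem_Wmin hK hX (Nat.one_div_pos_of_nat (α := ℝ) (n := m))
  have hlim : Filter.Tendsto Y Filter.atTop (nhds X.2) := by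
    refine tendsto_pi_nhds.2 fun i => tendsto_pi_nhds.2 fun a => tendsto_pi_nhds.2 fun b => ?_
    refine tendsto_iff_norm_sub_tendsto_zero.2 ?_
    exact squeeze_zero (fun _ => norm_nonneg _) (fun m => hYX m i a b)
      tendsto_one_div_add_atTop_nhds_zero_nat
  have hcl := (isCompact_rankOneData X.1 hK).convexHull_of_finiteDimensional.isClosed
  exact hcl.mem_of_tendsto ((tendsto_const_nhds.prodMk_nhds hlim).const_smul _)
    (Filter.Eventually.of_forall hY)

/-- Each point of `Wmin K` is a finite matrix convex combination of points of `K`. -/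
theorem exists_decomposition_of_mem_Wmin {d : ℕ} {K : Set (Fin d → ℂ)} (hK : IsCompact K)
    {X : FreeSpace d} (hX : X ∈ Wmin K) :
    ∃ (k : ℕ) (v : Fin k → Fin X.1 → ℂ) (x : Fin k → Fin d → ℂ), (∀ j, x j ∈ K) ∧
      (∀ j, v j ≠ 0) ∧ ∑ j, Matrix.vecMulVec (v j) (star (v j)) = 1 ∧
      ∀ i, X.2 i = ∑ j, x j i • Matrix.vecMulVec (v j) (star (v j)) := by
  have h := mem_convexHull_rankOneData_of_mem_Wmin hK hX
  obtain ⟨ι, _, z, w, hz, -, hw, hw1, hX⟩ := eq_pos_convex_span_of_mem_convexHull h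
  have hz' (j) : z j ∈ rankOneData X.1 K := hz ⟨j, rfl⟩
  choose p hp hpz using hz'
  have hn : (0 : ℝ) < (X.1 : ℕ) := by exact_mod_cast X.1.pos
  let e := (Fintype.equivFin ι).symm
  -- The factor `n` undoes the normalisation; the square root of `c j` is absorbed into the vector.
  let c : ι → ℝ := fun j => (X.1 : ℕ) * w j
  have hc (j) : 0 < c j := mul_pos hn (hw j)
  have hv (j) : Matrix.vecMulVec ((Real.sqrt (c j) : ℂ) • (p j).1)
      (star ((Real.sqrt (c j) : ℂ) • (p j).1)) =
      c j • Matrix.vecMulVec (p j).1 (star (p j).1) := by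
    ext a b
    have h2 : (Real.sqrt (c j) : ℂ) * Real.sqrt (c j) = c j := by
      rw [← Complex.ofReal_mul, Real.mul_self_sqrt (hc j).le]
    simp only [Matrix.vecMulVec_apply, Matrix.smul_apply, Pi.star_apply, Pi.smul_apply,
      smul_eq_mul, star_mul', Complex.real_smul, RCLike.star_def, Complex.conj_ofReal, ← h2]
    ring
  have hsum : ∑ j, c j • z j = (1, X.2) := by
    simp only [c, mul_smul]
    rw [← Finset.smul_sum, hX, smul_smul, mul_inv_cancel₀ hn.ne', one_smul]
  refine ⟨Fintype.card ι, fun j => (Real.sqrt (c (e j)) : ℂ) • (p (e j)).1, fun j => (p (e j)).2,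
    fun j => (hp (e j)).2, fun j => ?_, ?_, fun i => ?_⟩
  · refine smul_ne_zero (by exact_mod_cast (Real.sqrt_pos.2 (hc _)).ne') fun h0 => ?_
    have := (hp (e j)).1
    simp [h0] at this
  · simp_rw [hv]
    rw [e.sum_comp fun j => c j • Matrix.vecMulVec (p j).1 (star (p j).1)]
    have := congrArg Prod.fst hsum
    rw [Prod.fst_sum] at this
    refine Eq.trans ?_ this
    exact Finset.sum_congr rfl fun j _ => by rw [← hpz]; rfl
  · simp_rw [hv]
    rw [e.sum_comp fun j => (p j).2 i • c j • Matrix.vecMulVec (p j).1 (star (p j).1)]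
    have := congrFun (congrArg Prod.snd hsum) i
    rw [Prod.snd_sum, Finset.sum_apply] at this
    refine Eq.trans this.symm ?_
    exact Finset.sum_congr rfl fun j _ => by rw [← hpz, smul_comm]; rfl

/-! ### Level-one points, compressions and unitary equivalence -/

variable {d : ℕ}

instance (x : Fin d → ℂ) : Unique (Fin (ofPoint x).1) :=
  inferInstanceAs (Unique (Fin 1))

theorem ofPoint_apply_apply (x : Fin d → ℂ) (i : Fin d) (a b : Fin (ofPoint x).1) :
    (ofPoint x).2 i a b = x i := rfl

theorem ofPoint_apply (x : Fin d → ℂ) (i : Fin d) : (ofPoint x).2 i = x i • 1 := by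
  ext a b
  rw [Subsingleton.elim a b, ofPoint_apply_apply, Matrix.smul_apply, Matrix.one_apply_eq,
    smul_eq_mul, mul_one]

theorem vecMulVec_sqrt {x : Fin d → ℂ} {t : ℝ} (ht : 0 ≤ t) :
    Matrix.vecMulVec (fun _ : Fin (ofPoint x).1 => (Real.sqrt t : ℂ))
      (star fun _ : Fin (ofPoint x).1 => (Real.sqrt t : ℂ)) = (t : ℂ) • 1 := by
  ext i j
  rw [Subsingleton.elim i j]
  simp [Matrix.vecMulVec_apply, ← Complex.ofReal_mul, Real.mul_self_sqrt ht]

theorem ofPoint_mem_Wmin {K : Set (Fin d → ℂ)} {x : Fin d → ℂ} (hx : x ∈ K) :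
    ofPoint x ∈ Wmin K := by
  refine ⟨EuclideanSpace ℂ (Fin (ofPoint x).1), inferInstance, inferInstance, inferInstance,
    fun i => x i • 1, LinearIsometry.id, ⟨fun i => ⟨?_⟩, fun i j => ?_⟩, ?_, fun i => ?_⟩
  · rw [star_smul, star_one]
    exact ((Commute.one_left _).smul_left _).smul_right _
  · exact ((Commute.one_left _).smul_left _).smul_right _
  · rintro _ ⟨χ, rfl⟩
    convert hx using 1
    funext i
    refine (map_smul χ (x i) 1).trans ?_
    rw [map_one, smul_eq_mul, mul_one]
  · rw [ofPoint_apply, map_smul, map_one]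
    ext v : 1
    refine ext_inner_left ℂ fun w => ?_
    rw [ContinuousLinearMap.comp_apply, ContinuousLinearMap.adjoint_inner_right]
    rfl

/-- The same normal tuple serves, with the two isometries composed. -/
theorem compression_mem_Wmin {K : Set (Fin d → ℂ)} {X : FreeSpace d} (hX : X ∈ Wmin K) {m : ℕ+}
    (V : Matrix (Fin X.1) (Fin m) ℂ) (hV : Vᴴ * V = 1) :
    (⟨m, fun i => Vᴴ * X.2 i * V⟩ : FreeSpace d) ∈ Wmin K := by
  obtain ⟨H, _, _, _, N, W, hN, hNK, hW⟩ := hX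
  have hinner (x : EuclideanSpace ℂ (Fin X.1)) (y : EuclideanSpace ℂ (Fin m)) :
      inner ℂ (Matrix.toEuclideanLin V y) x = inner ℂ y (Matrix.toEuclideanLin Vᴴ x) := by
    rw [Matrix.toEuclideanLin_conjTranspose_eq_adjoint, LinearMap.adjoint_inner_right]
  let V' : EuclideanSpace ℂ (Fin m) →ₗᵢ[ℂ] EuclideanSpace ℂ (Fin X.1) :=
    (Matrix.toEuclideanLin V).isometryOfInner fun x y => by
      rw [hinner]
      congr 1
      ext a
      simp [Matrix.toLpLin_apply, Matrix.mulVec_mulVec, hV]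
  refine ⟨H, ‹_›, ‹_›, ‹_›, N, W.comp V', hN, hNK, fun i => ?_⟩
  ext v : 1
  refine ext_inner_left ℂ fun w => ?_
  have h1 := congr(inner ℂ (V' w) ($(hW i) (V' v)))
  rw [ContinuousLinearMap.comp_apply, ContinuousLinearMap.adjoint_inner_right] at h1 ⊢
  refine Eq.trans ?_ h1
  refine Eq.trans ?_ (hinner _ _).symm
  congr 1
  ext a
  simp [Matrix.toLpLin_apply, V', Matrix.mulVec_mulVec, Matrix.mul_assoc]

theorem UnitarilyEquivalent.symm {X Y : FreeSpace d} (h : UnitarilyEquivalent X Y) :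
    UnitarilyEquivalent Y X := by
  obtain ⟨U, h1, h2, h3⟩ := h
  refine ⟨Uᴴ, by simpa using h2, by simpa using h1, fun i => ?_⟩
  rw [h3, Matrix.conjTranspose_conjTranspose]
  calc X.2 i = (U * Uᴴ) * X.2 i * (U * Uᴴ) := by rw [h2, one_mul, mul_one]
    _ = _ := by simp only [Matrix.mul_assoc]

theorem UnitarilyEquivalent.size_eq {X Y : FreeSpace d} (h : UnitarilyEquivalent X Y) :
    X.1 = Y.1 := by
  obtain ⟨U, h1, h2, -⟩ := h
  have := Matrix.trace_mul_comm U Uᴴ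
  rw [h1, h2, Matrix.trace_one, Matrix.trace_one, Fintype.card_fin, Fintype.card_fin] at this
  exact PNat.coe_injective (by exact_mod_cast this)

theorem UnitarilyEquivalent.eq_ofPoint {x : Fin d → ℂ} {X : FreeSpace d}
    (h : UnitarilyEquivalent (ofPoint x) X) : X = ofPoint x := by
  have hsize := h.size_eq
  obtain ⟨U, h1, h2, h3⟩ := h
  obtain ⟨n, A⟩ := X
  obtain rfl : 1 = n := hsize
  have : A = (ofPoint x).2 := by
    funext i
    refine (h3 i).trans ?_
    rw [ofPoint_apply, Matrix.mul_smul, Matrix.smul_mul, Matrix.mul_one, h1]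
    rfl
  rw [this]
  rfl

theorem UnitarilyEquivalent.refl (X : FreeSpace d) : UnitarilyEquivalent X X :=
  ⟨1, by simp, by simp, by simp⟩

theorem ofPoint_injective : Function.Injective (ofPoint (d := d)) := by
  intro x y h
  funext i
  have h' := (Sigma.mk.injEq _ _ _ _ ▸ h : _ ∧ _).2
  exact congrFun (congrFun (congrFun (eq_of_heq h') i) 0) 0

theorem unitarilyEquivalent_ofPoint_iff {x : Fin d → ℂ} {X : FreeSpace d} :
    UnitarilyEquivalent X (ofPoint x) ↔ X = ofPoint x :=
  ⟨fun h => h.symm.eq_ofPoint, fun h => h ▸ UnitarilyEquivalent.refl _⟩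

/-! ### Matrix extreme points are extreme points -/

/-- In a proper combination the size of `Y i` is the rank of `V i`, at most the size of `X`, so `Y
i` is too small to be `X ⊕ Z`. -/
theorem AEP_subset_MEP (S : Set (FreeSpace d)) : AEP S ⊆ MEP S := by
  rintro X ⟨hX, h⟩
  refine ⟨hX, fun k Y V hc hr i => ?_⟩
  have hV (i) : V i ≠ 0 := fun h0 => by
    have := hr i
    rw [h0, Matrix.rank_zero] at this
    exact (Y i).1.ne_zero this.symm
  refine (h k Y V hc hV i).resolve_right ?_
  rintro ⟨Z, -, hZ⟩
  have h1 : ((Y i).1 : ℕ) = X.1 + Z.1 := congrArg PNat.val hZ.size_eq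
  have h2 := (V i).rank_le_width
  rw [hr i, h1] at h2
  have := Z.1.pos
  omega

/-- If a matrix extreme point is a matrix convex combination of points of `K`, it equals each of
them. -/
theorem eq_ofPoint_of_mem_MEP {K : Set (Fin d → ℂ)} {X : FreeSpace d} (hX : X ∈ MEP (Wmin K))
    {k : ℕ} {v : Fin k → Fin X.1 → ℂ} {x : Fin k → Fin d → ℂ} (hx : ∀ j, x j ∈ K)
    (hv : ∀ j, v j ≠ 0) (hv1 : ∑ j, Matrix.vecMulVec (v j) (star (v j)) = 1)
    (hvx : ∀ i, X.2 i = ∑ j, x j i • Matrix.vecMulVec (v j) (star (v j))) (j : Fin k) :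
    X = ofPoint (x j) := by
  -- The nonzero row `v_j*` has rank one, the size of a level-one point, so the combination is
  -- proper.
  let V : ∀ j, Matrix (Fin (ofPoint (x j)).1) (Fin X.1) ℂ := fun j =>
    Matrix.of fun _ a => star (v j a)
  have hV (j) : (V j)ᴴ * V j = Matrix.vecMulVec (v j) (star (v j)) := by
    ext a b
    rw [Matrix.mul_apply, Fintype.sum_unique, Matrix.conjTranspose_apply, Matrix.vecMulVec_apply]
    simp only [V, Matrix.of_apply, star_star, Pi.star_apply]
  refine (hX.2 k (fun j => ofPoint (x j)) V ⟨fun j => ofPoint_mem_Wmin (hx j), ?_, fun i => ?_⟩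
    (fun j => ?_) j).eq_ofPoint
  · simp_rw [hV, hv1]
  · simp_rw [ofPoint_apply, Matrix.mul_smul, Matrix.smul_mul, Matrix.mul_one, hV, hvx]
  · have hle : (V j).rank ≤ 1 := (V j).rank_le_height
    refine le_antisymm hle (Nat.one_le_iff_ne_zero.2 fun h0 => hv j ?_)
    rw [Matrix.rank, Submodule.finrank_eq_zero, LinearMap.range_eq_bot] at h0
    have : V j = 0 := by
      rw [← Matrix.toLin'_apply'] at h0
      exact Matrix.toLin'.map_eq_zero_iff.1 h0
    funext a
    exact star_eq_zero.1 (congrFun (congrFun this default) a)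

theorem MEP_Wmin_subset {K : Set (Fin d → ℂ)} (hK : IsCompact K) :
    MEP (Wmin K) ⊆ ofPoint '' K.extremePoints ℝ := by
  intro X hX
  obtain ⟨k, v, x, hxK, hv, hv1, hvx⟩ := exists_decomposition_of_mem_Wmin hK hX.1
  have hk : 0 < k := by
    refine Nat.pos_of_ne_zero fun hk => ?_
    subst hk
    have := congrFun (congrFun hv1 ⟨0, X.1.pos⟩) ⟨0, X.1.pos⟩
    simp at this
  obtain ⟨y, hyK, rfl⟩ : ∃ y ∈ K, X = ofPoint y :=
    ⟨_, hxK ⟨0, hk⟩, eq_ofPoint_of_mem_MEP hX hxK hv hv1 hvx ⟨0, hk⟩⟩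
  refine ⟨y, mem_extremePoints_iff_left.2 ⟨hyK, ?_⟩, rfl⟩
  rintro x₁ hx₁ x₂ hx₂ ⟨a, b, ha, hb, hab, rfl⟩
  set y := a • x₁ + b • x₂ with hy
  -- A scalar convex combination is a decomposition at level one with vectors `√a` and `√b`.
  refine (ofPoint_injective (eq_ofPoint_of_mem_MEP hX (k := 2)
    (v := ![fun _ => (Real.sqrt a : ℂ), fun _ => (Real.sqrt b : ℂ)]) (x := ![x₁, x₂])
    (fun j => ?_) (fun j => ?_) ?_ (fun i => ?_) 0)).symm
  · fin_cases j
    exacts [hx₁, hx₂]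
  · have hne {t : ℝ} (ht : 0 < t) : (fun _ : Fin (ofPoint y).1 => (Real.sqrt t : ℂ)) ≠ 0 :=
      fun h => by
        have := congrFun h default
        simp [Real.sqrt_eq_zero ht.le, ht.ne'] at this
    fin_cases j
    exacts [hne ha, hne hb]
  · simp only [Fin.sum_univ_two, Matrix.cons_val_zero, Matrix.cons_val_one,
      vecMulVec_sqrt ha.le, vecMulVec_sqrt hb.le]
    rw [← add_smul, ← Complex.ofReal_add, hab, Complex.ofReal_one, one_smul]
  · simp only [ofPoint_apply, Fin.sum_univ_two, Matrix.cons_val_zero, Matrix.cons_val_one,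
      vecMulVec_sqrt ha.le, vecMulVec_sqrt hb.le, smul_smul, ← add_smul]
    simp [hy, mul_comm]

/-! ### Extreme points are absolute extreme points -/

/-- Only the extreme point itself occurs in a convex combination representing it. -/
theorem eq_of_mem_extremePoints_of_sum_eq {E ι : Type*} [AddCommGroup E] [Module ℝ E]
    {K : Set E} (hK : Convex ℝ K) {x : E} (hx : x ∈ K.extremePoints ℝ) {t : Finset ι} {w : ι → ℝ}
    {z : ι → E} (hw : ∀ i ∈ t, 0 ≤ w i) (hw1 : ∑ i ∈ t, w i = 1) (hz : ∀ i ∈ t, z i ∈ K)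
    (hsum : ∑ i ∈ t, w i • z i = x) {i : ι} (hi : i ∈ t) (hwi : w i ≠ 0) : z i = x := by
  classical
  by_contra hne
  set s := t.filter fun j => z j ≠ x with hs
  have hpos : 0 < ∑ j ∈ s, w j :=
    Finset.sum_pos' (fun j hj => hw j (Finset.mem_filter.1 hj).1)
      ⟨i, Finset.mem_filter.2 ⟨hi, hne⟩, (hw i hi).lt_of_ne' hwi⟩
  -- Since `x` is extreme, `K \ {x}` is convex and contains the centre of mass of the points other
  -- than `x`. Cancelling the terms equal to `x` shows that this centre of mass is `x`.
  have hmem := (hK.mem_extremePoints_iff_convex_sdiff.1 hx).2.centerMass_mem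
    (t := s) (fun j hj => hw j (Finset.mem_filter.1 hj).1) hpos
    (fun j hj => ⟨hz j (Finset.mem_filter.1 hj).1, (Finset.mem_filter.1 hj).2⟩)
  refine hmem.2 ?_
  have h1 := Finset.sum_filter_add_sum_filter_not t (fun j => z j ≠ x) w
  have h2 := Finset.sum_filter_add_sum_filter_not t (fun j => z j ≠ x) fun j => w j • z j
  have h3 : ∑ j ∈ t with ¬ z j ≠ x, w j • z j = (∑ j ∈ t with ¬ z j ≠ x, w j) • x := by
    rw [Finset.sum_smul]
    refine Finset.sum_congr rfl fun j hj => ?_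
    rw [not_not.1 (Finset.mem_filter.1 hj).2]
  rw [h3, hsum, ← hs] at h2
  rw [hw1, ← hs] at h1
  rw [Set.mem_singleton_iff, Finset.centerMass, inv_smul_eq_iff₀ hpos.ne',
    eq_sub_of_add_eq h1, eq_sub_of_add_eq h2, sub_smul, one_smul]

theorem exists_eq_ofPoint {X : FreeSpace d} (hX : X.1 = 1) : ∃ y, X = ofPoint y := by
  obtain ⟨n, A⟩ := X
  obtain rfl : n = 1 := hX
  refine ⟨fun i => A i (0 : Fin 1) (0 : Fin 1), congrArg (Sigma.mk 1) ?_⟩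
  funext i
  have h (B : Matrix (Fin 1) (Fin 1) ℂ) : B = Matrix.of fun _ _ => B 0 0 := by
    ext a b
    rw [Subsingleton.elim a 0, Subsingleton.elim b 0, Matrix.of_apply]
  exact h (A i)

theorem unitarilyEquivalent_directSum {X Y Z : FreeSpace d}
    {U : Matrix (Fin Y.1) (Fin X.1 ⊕ Fin Z.1) ℂ} (h1 : Uᴴ * U = 1) (h2 : U * Uᴴ = 1)
    (h : ∀ i, Uᴴ * Y.2 i * U = Matrix.fromBlocks (X.2 i) 0 0 (Z.2 i)) :
    UnitarilyEquivalent Y (directSum X Z) := by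
  let e : Fin (X.1 + Z.1) ≃ Fin X.1 ⊕ Fin Z.1 := finSumFinEquiv.symm
  have h1' : (U.submatrix id e)ᴴ * U.submatrix id e = 1 := by
    have : (U.submatrix id e)ᴴ * U.submatrix id e = (Uᴴ * U).submatrix e e := rfl
    rw [this, h1, Matrix.submatrix_one_equiv]
  have h2' : U.submatrix id e * (U.submatrix id e)ᴴ = 1 := by
    rw [Matrix.conjTranspose_submatrix, Matrix.submatrix_mul_equiv, h2, Matrix.submatrix_id_id]
  refine ⟨U.submatrix id e, h1', h2', fun i => ?_⟩
  exact (congrArg (fun A => A.submatrix e e) (h i)).symm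

/-- A point with a reducing joint eigenvector splits off a point of the first level. -/
theorem unitarilyEquivalent_directSum_of_eigenvector {K : Set (Fin d → ℂ)} {Y : FreeSpace d}
    (hY : Y ∈ Wmin K) {x : Fin d → ℂ} {u : Fin Y.1 → ℂ} (hu : u ≠ 0)
    (h1 : ∀ i, Y.2 i *ᵥ u = x i • u) (h2 : ∀ i, star u ᵥ* Y.2 i = x i • star u) :
    UnitarilyEquivalent Y (ofPoint x) ∨
      ∃ Z ∈ Wmin K, UnitarilyEquivalent Y (directSum (ofPoint x) Z) := by
  by_cases hone : Y.1 = 1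
  · left
    obtain ⟨y, rfl⟩ := exists_eq_ofPoint hone
    obtain rfl : y = x := by
      funext i
      refine smul_left_injective ℂ hu ?_
      simp only [← h1, ofPoint_apply, Matrix.smul_mulVec, Matrix.one_mulVec]
    exact UnitarilyEquivalent.refl _
  · right
    have hlt : 1 < (Y.1 : ℕ) := by
      have h0 := Y.1.pos
      have : (Y.1 : ℕ) ≠ 1 := fun h => hone (PNat.coe_injective h)
      omega
    obtain ⟨m, hm⟩ : ∃ m : ℕ+, (Y.1 : ℕ) = 1 + m := ⟨⟨Y.1 - 1, by omega⟩, by simp; omega⟩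
    let e : EuclideanSpace ℂ (Fin Y.1) := WithLp.toLp 2 u
    have he : e ≠ 0 := fun h => hu (by simpa [e] using h)
    have hne : ‖e‖ ≠ 0 := norm_ne_zero_iff.2 he
    have hv : Orthonormal ℂ (({Sum.inl 0} : Set (Fin 1 ⊕ Fin m)).domRestrict
        fun _ => (‖e‖⁻¹ : ℂ) • e) := by
      refine ⟨fun i => ?_, fun i j hij => (hij (Subsingleton.elim _ _)).elim⟩
      rw [Set.domRestrict_apply, norm_smul, norm_inv, Complex.norm_real, norm_norm,
        inv_mul_cancel₀ hne]
    obtain ⟨b, hb⟩ := hv.exists_orthonormalBasis_extension_of_card_eq (by simp [hm])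
    have hb0 : b (Sum.inl 0) = (‖e‖⁻¹ : ℂ) • e := hb _ rfl
    let U₁ : Matrix (Fin Y.1) (Fin 1) ℂ := Matrix.of fun a k => b (Sum.inl k) a
    let U₂ : Matrix (Fin Y.1) (Fin m) ℂ := Matrix.of fun a k => b (Sum.inr k) a
    let U : Matrix (Fin Y.1) (Fin 1 ⊕ Fin m) ℂ := Matrix.fromCols U₁ U₂
    have hUU : Uᴴ * U = 1 := by
      ext p q
      have := b.inner_eq_ite p q
      rw [EuclideanSpace.inner_eq_star_dotProduct] at this
      rw [Matrix.one_apply, ← this, Matrix.mul_apply, dotProduct]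
      refine Finset.sum_congr rfl fun a _ => ?_
      rcases p with p | p <;> rcases q with q | q <;>
        simp [U, U₁, U₂, mul_comm]
    have hblock := hUU
    rw [Matrix.conjTranspose_fromCols_eq_fromRows_conjTranspose, Matrix.fromRows_mul_fromCols,
      ← Matrix.fromBlocks_one, Matrix.fromBlocks_inj] at hblock
    obtain ⟨h11, h12, h21, h22⟩ := hblock
    have hcol (a k) : U₁ a k = (‖e‖⁻¹ : ℂ) * u a := by
      rw [Subsingleton.elim k 0]
      simp [U₁, hb0, e]
    have hYU (i) : Y.2 i * U₁ = x i • U₁ := by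
      ext a k
      have := congrFun (h1 i) a
      simp only [Matrix.mulVec, dotProduct, Pi.smul_apply, smul_eq_mul] at this
      simp only [Matrix.mul_apply, hcol, Matrix.smul_apply, smul_eq_mul]
      rw [mul_left_comm, ← this, Finset.mul_sum]
      exact Finset.sum_congr rfl fun _ _ => by ring
    have hUY (i) : U₁ᴴ * Y.2 i = x i • U₁ᴴ := by
      ext k a
      have := congrFun (h2 i) a
      simp only [Matrix.vecMul, dotProduct, Pi.smul_apply, smul_eq_mul, Pi.star_apply] at this
      simp only [Matrix.mul_apply, hcol, Matrix.smul_apply, smul_eq_mul, Matrix.conjTranspose_apply,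
        star_mul']
      rw [mul_left_comm, ← this, Finset.mul_sum]
      exact Finset.sum_congr rfl fun _ _ => by ring
    -- The right and left eigenvector equations each annihilate one off-diagonal block, because the
    -- columns of `U₁` and `U₂` are orthogonal.
    have hcomp (i) : Uᴴ * Y.2 i * U = Matrix.fromBlocks ((ofPoint x).2 i) 0 0 (U₂ᴴ * Y.2 i * U₂) := by
      rw [Matrix.conjTranspose_fromCols_eq_fromRows_conjTranspose, Matrix.fromRows_mul,
        Matrix.fromRows_mul_fromCols, hUY, Matrix.smul_mul, Matrix.smul_mul, h11, h12,
        Matrix.mul_assoc U₂ᴴ _ U₁, hYU, Matrix.mul_smul, h21, smul_zero, smul_zero, ofPoint_apply]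
      rfl
    have hUU' : U * Uᴴ = 1 :=
      (Matrix.mul_eq_one_comm_of_equiv (finSumFinEquiv.trans (finCongr hm.symm))).1 hUU
    refine ⟨⟨m, fun i => U₂ᴴ * Y.2 i * U₂⟩, compression_mem_Wmin hY U₂ h22,
      unitarilyEquivalent_directSum (U := U) hUU hUU' hcomp⟩

theorem ofPoint_mem_AEP {K : Set (Fin d → ℂ)} (hK : IsCompact K) (hconv : Convex ℝ K)
    {x : Fin d → ℂ} (hx : x ∈ K.extremePoints ℝ) : ofPoint x ∈ AEP (Wmin K) := by
  refine ⟨ofPoint_mem_Wmin hx.1, fun k Y V hc hV i => ?_⟩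
  choose m v z hzK _ hv1 hvz using fun i => exists_decomposition_of_mem_Wmin hK (hc.mem i)
  let u : ∀ i, Fin (Y i).1 → ℂ := fun i a => V i a default
  have hu (i) : u i ≠ 0 := fun h => hV i (by
    ext a b
    rw [Subsingleton.elim b default]
    exact congrFun h a)
  have hquad (i) (w : Fin (Y i).1 → ℂ) :
      ((V i)ᴴ * Matrix.vecMulVec w (star w) * V i) default default =
        ((‖star w ⬝ᵥ u i‖ ^ 2 : ℝ) : ℂ) := by
    rw [← Complex.normSq_eq_norm_sq, ← Complex.mul_conj, Matrix.mul_vecMulVec,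
      Matrix.vecMulVec_mul, Matrix.vecMulVec_apply, mul_comm]
    congr 1
    rw [starRingEnd_apply, Matrix.star_dotProduct, star_star]
    rfl
  -- Inserting the resolution of the identity of each `Y i` into `∑ V_i* V_i = 1` turns it into a
  -- sum of scalar weights.
  have hweight : ∑ p : Σ i, Fin (m i), ‖star (v p.1 p.2) ⬝ᵥ u p.1‖ ^ 2 = 1 := by
    have h := congrFun (congrFun hc.sum_eq_one default) default
    have h' : ((∑ p : Σ i, Fin (m i), ‖star (v p.1 p.2) ⬝ᵥ u p.1‖ ^ 2 : ℝ) : ℂ) = 1 := by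
      refine Eq.trans ?_ (h.trans (Matrix.one_apply_eq _))
      rw [Fintype.sum_sigma, Complex.ofReal_sum, Matrix.sum_apply]
      refine Finset.sum_congr rfl fun i _ => ?_
      rw [← Matrix.mul_one (V i)ᴴ, ← hv1 i, Matrix.mul_sum, Matrix.sum_mul, Matrix.sum_apply,
        Complex.ofReal_sum]
      exact Finset.sum_congr rfl fun j _ => (hquad i (v i j)).symm
    exact_mod_cast h'
  have hbary : ∑ p : Σ i, Fin (m i), ‖star (v p.1 p.2) ⬝ᵥ u p.1‖ ^ 2 • z p.1 p.2 = x := by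
    funext l
    have h := congrFun (congrFun (hc.eq_sum l) default) default
    refine Eq.trans ?_ h.symm
    rw [Finset.sum_apply, Fintype.sum_sigma, Matrix.sum_apply]
    refine Finset.sum_congr rfl fun i _ => ?_
    rw [hvz i l, Matrix.mul_sum, Matrix.sum_mul, Matrix.sum_apply]
    refine Finset.sum_congr rfl fun j _ => ?_
    rw [Matrix.mul_smul, Matrix.smul_mul, Matrix.smul_apply, hquad, Pi.smul_apply,
      Complex.real_smul, smul_eq_mul, mul_comm]
  have hz (i j) (h : star (v i j) ⬝ᵥ u i ≠ 0) : z i j = x :=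
    eq_of_mem_extremePoints_of_sum_eq hconv hx (t := Finset.univ)
      (w := fun p : Σ i, Fin (m i) => ‖star (v p.1 p.2) ⬝ᵥ u p.1‖ ^ 2) (z := fun p => z p.1 p.2)
      (fun _ _ => by positivity) hweight (fun p _ => hzK p.1 p.2) hbary
      (Finset.mem_univ (⟨i, j⟩ : Σ i, Fin (m i))) (by simpa using h)
  refine unitarilyEquivalent_directSum_of_eigenvector (hc.mem i) (hu i) (fun l => ?_) fun l => ?_
  -- Expand `u i` through `∑ v_j v_j* = 1`: a term with `⟨v_j, u_i⟩ = 0` vanishes, and in every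
  -- other term the point is `x`.
  · conv_rhs => rw [← Matrix.one_mulVec (u i), ← hv1 i]
    rw [hvz i l, Matrix.sum_mulVec, Matrix.sum_mulVec, Finset.smul_sum]
    refine Finset.sum_congr rfl fun j _ => ?_
    rw [Matrix.smul_mulVec, Matrix.vecMulVec_mulVec]
    by_cases h : star (v i j) ⬝ᵥ u i = 0
    · simp [h]
    · rw [hz i j h]
  · conv_rhs => rw [← Matrix.vecMul_one (star (u i)), ← hv1 i]
    rw [hvz i l, Matrix.vecMul_sum, Matrix.vecMul_sum, Finset.smul_sum]
    refine Finset.sum_congr rfl fun j _ => ?_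
    rw [Matrix.vecMul_smul, Matrix.vecMul_vecMulVec]
    by_cases h : star (v i j) ⬝ᵥ u i = 0
    · have : star (u i) ⬝ᵥ v i j = 0 := by
        rw [← star_eq_zero, ← Matrix.star_dotProduct_star, star_star, h]
      simp [this]
    · rw [hz i j h]

/-! ### Matrix convex sets generated by level-one points -/

/-- Compression by an isometry as a linear map. -/
def compression {m k : ℕ} (V : Matrix (Fin m) (Fin k) ℂ) :
    Matrix (Fin m) (Fin m) ℂ →ₗ[ℂ] Matrix (Fin k) (Fin k) ℂ where
  toFun A := Vᴴ * A * V
  map_add' A B := by rw [Matrix.mul_add, Matrix.add_mul]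
  map_smul' c A := by rw [Matrix.mul_smul, Matrix.smul_mul, RingHom.id_apply]

/-- Each amplification is conjugation by `1 ⊗ V`. -/
theorem isUCP_compression {m k : ℕ} {V : Matrix (Fin m) (Fin k) ℂ} (hV : Vᴴ * V = 1) :
    IsUCP (compression V) := by
  refine ⟨by simp [compression, hV], fun r A hA => ?_⟩
  let D : Matrix (Fin r × Fin m) (Fin r × Fin k) ℂ := (1 : Matrix (Fin r) (Fin r) ℂ) ⊗ₖ V
  have : Matrix.comp (Fin r) (Fin r) (Fin k) (Fin k) ℂ (A.map (compression V)) =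
      Dᴴ * Matrix.comp (Fin r) (Fin r) (Fin m) (Fin m) ℂ A * D := by
    ext ⟨p, a⟩ ⟨q, b⟩
    simp [D, compression, Matrix.mul_apply, Fintype.sum_prod_type, Matrix.one_apply,
      apply_ite (starRingEnd ℂ), ite_mul, Finset.sum_ite_irrel]
  rw [this]
  exact hA.conjTranspose_mul_mul_same D

theorem IsMatrixConvex.compression_mem {T : Set (FreeSpace d)} (hT : IsMatrixConvex T)
    {Y : FreeSpace d} (hY : Y ∈ T) {n : ℕ+} {V : Matrix (Fin Y.1) (Fin n) ℂ} (hV : Vᴴ * V = 1) :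
    (⟨n, fun i => Vᴴ * Y.2 i * V⟩ : FreeSpace d) ∈ T :=
  hT.ucp_mem Y hY n (compression V) (isUCP_compression hV)

/-- Iterated direct sums; there are `k + 1` points because no level zero exists. -/
theorem IsMatrixConvex.exists_diagonal_mem {T : Set (FreeSpace d)} (hT : IsMatrixConvex T) {k : ℕ}
    (x : Fin (k + 1) → Fin d → ℂ) (hx : ∀ j, ofPoint (x j) ∈ T) :
    ∃ Y ∈ T, ∃ e : Fin Y.1 ≃ Fin (k + 1), ∀ i, Y.2 i = Matrix.diagonal fun a => x (e a) i := by
  induction k with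
  | zero =>
    let e : Fin (ofPoint (x 0)).1 ≃ Fin 1 := Equiv.refl _
    refine ⟨ofPoint (x 0), hx 0, e, fun i => ?_⟩
    ext a b
    rw [Subsingleton.elim a b, Matrix.diagonal_apply_eq, ofPoint_apply_apply,
      Subsingleton.elim (e b) 0]
  | succ k ih =>
    obtain ⟨Y, hY, e, he⟩ := ih (fun j => x j.castSucc) fun j => hx _
    let y := x (Fin.last (k + 1))
    let e₀ : Fin (ofPoint y).1 ≃ Fin 1 := Equiv.refl _
    let e₁ : Fin Y.1 ⊕ Fin (ofPoint y).1 ≃ Fin (k + 1 + 1) := (e.sumCongr e₀).trans finSumFinEquiv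
    let e₂ : Fin (Y.1 + (ofPoint y).1) ≃ Fin Y.1 ⊕ Fin (ofPoint y).1 := finSumFinEquiv.symm
    refine ⟨directSum Y (ofPoint y), hT.directSum_mem _ hY _ (hx _), e₂.trans e₁, fun i => ?_⟩
    have h : Matrix.fromBlocks (Y.2 i) 0 0 ((ofPoint y).2 i) =
        Matrix.diagonal fun a => x (e₁ a) i := by
      ext p q
      rcases p with p | p <;> rcases q with q | q
      · rw [Matrix.fromBlocks_apply₁₁, he, Matrix.diagonal_apply, Matrix.diagonal_apply]
        simp only [Sum.inl.injEq]
        rfl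
      · rw [Matrix.fromBlocks_apply₁₂, Matrix.diagonal_apply_ne _ Sum.inl_ne_inr]
        rfl
      · rw [Matrix.fromBlocks_apply₂₁, Matrix.diagonal_apply_ne _ Sum.inr_ne_inl]
        rfl
      · rw [Matrix.fromBlocks_apply₂₂, Subsingleton.elim p q, Matrix.diagonal_apply_eq,
          ofPoint_apply_apply, Subsingleton.elim q default]
        rfl
    exact (congrArg (fun A => A.submatrix e₂ e₂) h).trans (Matrix.submatrix_diagonal_equiv _ e₂)

/-- Stacking the rows `v_j*` gives an isometry, and `X` is the compression by it of the diagonal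
tuple of the `x_j`. -/
theorem IsMatrixConvex.mem_of_decomposition {T : Set (FreeSpace d)} (hT : IsMatrixConvex T) {k : ℕ}
    {X : FreeSpace d} {v : Fin k → Fin X.1 → ℂ} {x : Fin k → Fin d → ℂ}
    (hx : ∀ j, ofPoint (x j) ∈ T) (hv1 : ∑ j, Matrix.vecMulVec (v j) (star (v j)) = 1)
    (hvx : ∀ i, X.2 i = ∑ j, x j i • Matrix.vecMulVec (v j) (star (v j))) : X ∈ T := by
  cases k with
  | zero =>
    have := congrFun (congrFun hv1 ⟨0, X.1.pos⟩) ⟨0, X.1.pos⟩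
    simp at this
  | succ k =>
    obtain ⟨Y, hY, e, he⟩ := hT.exists_diagonal_mem x hx
    let V : Matrix (Fin Y.1) (Fin X.1) ℂ := Matrix.of fun a b => star (v (e a) b)
    have hV : Vᴴ * V = 1 := by
      rw [← hv1, ← e.sum_comp fun j => Matrix.vecMulVec (v j) (star (v j))]
      ext a b
      simp [V, Matrix.mul_apply, Matrix.sum_apply, Matrix.vecMulVec_apply]
    convert hT.compression_mem hY hV using 1
    refine Sigma.ext rfl (heq_of_eq (funext fun i => ?_))
    refine Eq.trans ?_ (congrArg (fun A => Vᴴ * A * V) (he i).symm)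
    rw [hvx, ← e.sum_comp fun j => x j i • Matrix.vecMulVec (v j) (star (v j))]
    ext a b
    rw [Matrix.mul_apply]
    simp only [V, Matrix.sum_apply, Matrix.vecMulVec_apply, Matrix.smul_apply,
      Matrix.mul_diagonal, Matrix.conjTranspose_apply, Matrix.of_apply, star_star, Pi.star_apply,
      smul_eq_mul]
    exact Finset.sum_congr rfl fun _ _ => by ring

theorem isClosed_setOf_ofPoint_mem {T : Set (FreeSpace d)} (hT : IsLevelClosed T) :
    IsClosed {x | ofPoint x ∈ T} := by
  have h : Continuous fun (x : Fin d → ℂ) (i : Fin d) =>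
      (Matrix.of fun _ _ => x i : Matrix (Fin 1) (Fin 1) ℂ) :=
    continuous_pi fun i => continuous_matrix fun _ _ => continuous_apply i
  exact (hT 1).preimage h

theorem IsMatrixConvex.convex_setOf_ofPoint_mem {T : Set (FreeSpace d)} (hT : IsMatrixConvex T) :
    Convex ℝ {x | ofPoint x ∈ T} := by
  intro x hx y hy a b ha hb hab
  set z := a • x + b • y with hz
  refine hT.mem_of_decomposition (X := ofPoint z) (k := 2)
    (v := ![fun _ => (Real.sqrt a : ℂ), fun _ => (Real.sqrt b : ℂ)]) (x := ![x, y])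
    (fun j => ?_) ?_ fun i => ?_
  · fin_cases j
    exacts [hx, hy]
  · simp only [Fin.sum_univ_two, Matrix.cons_val_zero, Matrix.cons_val_one,
      vecMulVec_sqrt ha, vecMulVec_sqrt hb]
    rw [← add_smul, ← Complex.ofReal_add, hab, Complex.ofReal_one, one_smul]
  · simp only [ofPoint_apply, Fin.sum_univ_two, Matrix.cons_val_zero, Matrix.cons_val_one,
      vecMulVec_sqrt ha, vecMulVec_sqrt hb, smul_smul, ← add_smul]
    simp [hz, mul_comm]

/-- A closed matrix convex set containing the extreme points of `K` contains `Wmin K`. -/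
theorem Wmin_subset {K : Set (Fin d → ℂ)} (hK : IsCompact K) (hconv : Convex ℝ K)
    {T : Set (FreeSpace d)} (hT : IsMatrixConvex T) (hTc : IsLevelClosed T)
    (hext : ofPoint '' K.extremePoints ℝ ⊆ T) : Wmin K ⊆ T := by
  have hKT : K ⊆ {x | ofPoint x ∈ T} := by
    rw [← closure_convexHull_extremePoints hK hconv]
    exact closure_minimal (convexHull_min (Set.image_subset_iff.1 hext)
      hT.convex_setOf_ofPoint_mem) (isClosed_setOf_ofPoint_mem hTc)
  intro X hX
  obtain ⟨k, v, x, hxK, -, hv1, hvx⟩ := exists_decomposition_of_mem_Wmin hK hX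
  exact hT.mem_of_decomposition (fun j => hKT (hxK j)) hv1 hvx

/-! ### Matrix convex half-spaces -/

/-- The Hermitian matrix `2 c - 2 Re (∑ aᵢ Xᵢ)`. -/
noncomputable def pencil (a : Fin d → ℂ) (c : ℝ) {n : Type*} [DecidableEq n]
    (X : Fin d → Matrix n n ℂ) : Matrix n n ℂ :=
  ((2 * c : ℝ) : ℂ) • 1 - ∑ i, a i • X i - (∑ i, a i • X i)ᴴ

/-- The matrix convex half-space of all tuples on which a pencil is positive semidefinite. -/
def halfSpace (a : Fin d → ℂ) (c : ℝ) : Set (FreeSpace d) :=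
  {X | (pencil a c X.2).PosSemidef}

theorem isHermitian_pencil (a : Fin d → ℂ) (c : ℝ) {n : Type*} [DecidableEq n]
    (X : Fin d → Matrix n n ℂ) : (pencil a c X).IsHermitian := by
  rw [Matrix.IsHermitian, pencil, Matrix.conjTranspose_sub, Matrix.conjTranspose_sub,
    Matrix.conjTranspose_smul, Matrix.conjTranspose_one, Matrix.conjTranspose_conjTranspose,
    sub_right_comm]
  simp

theorem pencil_fromBlocks (a : Fin d → ℂ) (c : ℝ) {m n : Type*} [DecidableEq m] [DecidableEq n]
    (X : Fin d → Matrix m m ℂ) (Y : Fin d → Matrix n n ℂ) :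
    pencil a c (fun i => Matrix.fromBlocks (X i) 0 0 (Y i)) =
      Matrix.fromBlocks (pencil a c X) 0 0 (pencil a c Y) := by
  ext (p | p) (q | q) <;> simp [pencil, Matrix.sum_apply, Matrix.one_apply]

theorem pencil_submatrix (a : Fin d → ℂ) (c : ℝ) {m n : Type*} [DecidableEq m] [DecidableEq n]
    (X : Fin d → Matrix n n ℂ) (e : m ≃ n) :
    pencil a c (fun i => (X i).submatrix e e) = (pencil a c X).submatrix e e := by
  ext p q
  simp [pencil, Matrix.sum_apply, Matrix.one_apply]

theorem isLevelClosed_halfSpace (a : Fin d → ℂ) (c : ℝ) : IsLevelClosed (halfSpace a c) := by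
  intro n
  have : level (halfSpace a c) n =
      ⋂ v : Fin n → ℂ, {X | 0 ≤ star v ⬝ᵥ (pencil a c X *ᵥ v)} := by
    ext X
    simp only [level, halfSpace, Set.mem_ofPred_eq, Set.mem_iInter]
    exact ⟨fun h => h.dotProduct_mulVec_nonneg,
      fun h => Matrix.PosSemidef.of_dotProduct_mulVec_nonneg (isHermitian_pencil a c X) h⟩
  rw [this]
  refine isClosed_iInter fun v => isClosed_le continuous_const ?_
  unfold pencil
  fun_prop

theorem posSemidef_fromBlocks_zero {m n : Type*} [Fintype m] [Fintype n]
    {A : Matrix m m ℂ} {B : Matrix n n ℂ} (hA : A.PosSemidef) (hB : B.PosSemidef) : (Matrix.fromBlocks A 0 0 B).PosSemidef := by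
  refine Matrix.PosSemidef.of_dotProduct_mulVec_nonneg
    (hA.isHermitian.fromBlocks (by simp) hB.isHermitian) fun x => ?_
  have := add_nonneg (hA.dotProduct_mulVec_nonneg (x ∘ Sum.inl))
    (hB.dotProduct_mulVec_nonneg (x ∘ Sum.inr))
  rw [Matrix.fromBlocks_mulVec]
  simpa [dotProduct] using this

/-- The block matrix with rows `(A* A, A*)` and `(A, 1)` is positive semidefinite; its image is
Hermitian, and comparing off-diagonal blocks gives the claim. -/
theorem IsUCP.map_conjTranspose {m k : ℕ}
    {φ : Matrix (Fin m) (Fin m) ℂ →ₗ[ℂ] Matrix (Fin k) (Fin k) ℂ} (hφ : IsUCP φ)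
    (A : Matrix (Fin m) (Fin m) ℂ) : φ Aᴴ = (φ A)ᴴ := by
  have hA := hφ.map_posSemidef 2 (Matrix.of ![![Aᴴ * A, Aᴴ], ![A, 1]]) (by
    let D : Matrix (Fin m) (Fin 2 × Fin m) ℂ := Matrix.of fun a p => ![A, 1] p.1 a p.2
    convert Matrix.posSemidef_conjTranspose_mul_self D
    ext ⟨p, a⟩ ⟨q, b⟩
    fin_cases p <;> fin_cases q <;> simp [D, Matrix.mul_apply, Matrix.one_apply, eq_comm])
  ext a b
  have := congrFun (congrFun hA.isHermitian (0, a)) (1, b)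
  simpa using this.symm

theorem IsUCP.map_posSemidef_one {m k : ℕ}
    {φ : Matrix (Fin m) (Fin m) ℂ →ₗ[ℂ] Matrix (Fin k) (Fin k) ℂ} (hφ : IsUCP φ)
    {A : Matrix (Fin m) (Fin m) ℂ} (hA : A.PosSemidef) : (φ A).PosSemidef := by
  have := hφ.map_posSemidef 1 (Matrix.of fun _ _ => A) (hA.submatrix Prod.snd)
  exact this.submatrix fun a => ((0 : Fin 1), a)

/-- Forming the pencil commutes with direct sums and with unital maps that preserve adjoints. -/
theorem isMatrixConvex_halfSpace (a : Fin d → ℂ) (c : ℝ) : IsMatrixConvex (halfSpace a c) := by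
  refine ⟨fun X hX Y hY => ?_, fun X hX k φ hφ => ?_⟩
  · let e : Fin (X.1 + Y.1) ≃ Fin X.1 ⊕ Fin Y.1 := finSumFinEquiv.symm
    have h := (posSemidef_fromBlocks_zero hX hY).submatrix e
    rw [← pencil_fromBlocks, ← pencil_submatrix] at h
    exact h
  · change (pencil a c fun i => φ (X.2 i)).PosSemidef
    convert hφ.map_posSemidef_one hX using 1
    simp only [pencil, map_sub, map_smul, map_sum, hφ.map_one, hφ.map_conjTranspose]

theorem ofPoint_mem_halfSpace_iff {a : Fin d → ℂ} {c : ℝ} {x : Fin d → ℂ} :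
    ofPoint x ∈ halfSpace a c ↔ (∑ i, a i * x i).re ≤ c := by
  have h : pencil a c (ofPoint x).2 = ((2 * (c - (∑ i, a i * x i).re) : ℝ) : ℂ) • 1 := by
    ext p q
    rw [Subsingleton.elim p q]
    have h1 := Complex.add_conj (∑ i, a i * x i)
    simp only [pencil, Matrix.sub_apply, Matrix.smul_apply, Matrix.one_apply_eq, Matrix.sum_apply,
      Matrix.conjTranspose_apply, ofPoint_apply_apply, smul_eq_mul, mul_one]
    rw [← starRingEnd_apply, sub_sub, h1]
    push_cast
    ring
  change (pencil a c (ofPoint x).2).PosSemidef ↔ _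
  rw [h]
  refine ⟨fun hp => ?_, fun hc => Matrix.PosSemidef.one.smul ?_⟩
  · have := hp.diag_nonneg (i := default)
    rw [Matrix.smul_apply, Matrix.one_apply_eq, smul_eq_mul, mul_one, Complex.zero_le_real] at this
    linarith
  · rw [Complex.zero_le_real]
    linarith

/-- A point outside a compact convex set is separated from it by a matrix convex half-space. -/
theorem exists_halfSpace {C : Set (Fin d → ℂ)} (hC : IsCompact C) (hconv : Convex ℝ C)
    {x : Fin d → ℂ} (hx : x ∉ C) :
    ∃ (a : Fin d → ℂ) (c : ℝ), (∀ y ∈ C, ofPoint y ∈ halfSpace a c) ∧ ofPoint x ∉ halfSpace a c := by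
  obtain ⟨f, c, hf, hc⟩ := RCLike.geometric_hahn_banach_closed_point (𝕜 := ℂ) hconv hC.isClosed hx
  have hfa (y : Fin d → ℂ) : f y = ∑ i, f (Pi.single i 1) * y i := by
    conv_lhs => rw [pi_eq_sum_univ' y, map_sum]
    refine Finset.sum_congr rfl fun i _ => ?_
    rw [map_smul, smul_eq_mul, mul_comm]
  refine ⟨fun i => f (Pi.single i 1), c, fun y hy => ?_, ?_⟩
  · rw [ofPoint_mem_halfSpace_iff, ← hfa]
    exact (hf y hy).le
  · rw [ofPoint_mem_halfSpace_iff, ← hfa, not_le]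
    exact hc

/-! ### Crucial matrix extreme points -/

/-- Milman's converse: an isolated extreme point is not in the closed convex hull of the others. -/
theorem notMem_convexHull_closure {K : Set (Fin d → ℂ)} (hK : IsCompact K) (hconv : Convex ℝ K)
    {x : Fin d → ℂ} (hx : x ∈ isolatedExtremePoints K) :
    x ∉ convexHull ℝ (closure (K.extremePoints ℝ \ {x})) := by
  intro hmem
  obtain ⟨hxe, U, hU, hUx⟩ := hx
  have hsub : convexHull ℝ (closure (K.extremePoints ℝ \ {x})) ⊆ K :=
    convexHull_min (closure_minimal (Set.sdiff_subset.trans extremePoints_subset) hK.isClosed) hconv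
  -- An extreme point of `K` lying in the smaller hull is extreme there, hence belongs to the
  -- generating closure.
  have hcl := extremePoints_convexHull_subset
    (inter_extremePoints_subset_extremePoints_of_subset hsub ⟨hmem, hxe⟩)
  have hxU : x ∈ U := (hUx.symm ▸ Set.mem_singleton x : x ∈ U ∩ _).1
  obtain ⟨y, hyU, hye, hyx⟩ := mem_closure_iff.1 hcl U hU hxU
  exact hyx (hUx ▸ ⟨hyU, hye⟩ : y ∈ ({x} : Set _))

theorem crucialMEP_Wmin {K : Set (Fin d → ℂ)} (hK : IsCompact K) (hconv : Convex ℝ K)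
    (hMEP : MEP (Wmin K) = ofPoint '' K.extremePoints ℝ) :
    crucialMEP (Wmin K) = ofPoint '' isolatedExtremePoints K := by
  apply Set.Subset.antisymm
  · rintro X ⟨hX, hXc⟩
    simp only [closedMatrixConvexHull, Set.mem_sInter, Set.mem_ofPred_eq, not_forall, hMEP] at hXc
    obtain ⟨T, ⟨hsub, hT, hTc⟩, hXT⟩ := hXc
    by_cases hXe : X ∈ ofPoint '' K.extremePoints ℝ
    · obtain ⟨x, hx, rfl⟩ := hXe
      -- The closed set `T` contains all other extreme points but not `x`, so the complement of its
      -- first level isolates `x`.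
      refine ⟨x, ⟨hx, {y | ofPoint y ∈ T}ᶜ, (isClosed_setOf_ofPoint_mem hTc).isOpen_compl, ?_⟩, rfl⟩
      refine Set.Subset.antisymm ?_ (Set.singleton_subset_iff.2 ⟨hXT, hx⟩)
      rintro y ⟨hyT, hy⟩
      by_contra hne
      refine hyT (hsub ⟨⟨y, hy, rfl⟩, fun h => hne ?_⟩)
      exact ofPoint_injective (unitarilyEquivalent_ofPoint_iff.1 h)
    -- If `X` is not extreme, no extreme point was discarded, so `T` contains all of `Wmin K`.
    · refine (hXT (Wmin_subset hK hconv hT hTc (fun Y hY => hsub ⟨hY, fun h => hXe ?_⟩) hX)).elim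
      obtain ⟨y, hy, rfl⟩ := hY
      rw [h.eq_ofPoint]
      exact ⟨y, hy, rfl⟩
  · rintro _ ⟨x, hx, rfl⟩
    refine ⟨ofPoint_mem_Wmin hx.1.1, fun hmem => ?_⟩
    have hcomp : IsCompact (convexHull ℝ (closure (K.extremePoints ℝ \ {x}))) :=
      (hK.closure_of_subset
        (Set.sdiff_subset.trans extremePoints_subset)).convexHull_of_finiteDimensional
    obtain ⟨a, c, ha, hax⟩ := exists_halfSpace hcomp (convex_convexHull ℝ _)
      (notMem_convexHull_closure hK hconv hx)
    refine hax (hmem _ ⟨?_, isMatrixConvex_halfSpace a c, isLevelClosed_halfSpace a c⟩)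
    rintro M ⟨hM, hMx⟩
    rw [hMEP] at hM
    obtain ⟨y, hy, rfl⟩ := hM
    refine ha y (subset_convexHull ℝ _ (subset_closure ⟨hy, fun h => hMx ?_⟩))
    rw [Set.mem_singleton_iff] at h
    rw [h]
    exact UnitarilyEquivalent.refl _

end MatrixConvex

theorem proposition2p3 (d : ℕ) (K : Set (Fin d → ℂ)) (hK : IsCompact K) (hconv : Convex ℝ K) :
    MatrixConvex.ofPoint '' K.extremePoints ℝ = MatrixConvex.MEP (MatrixConvex.Wmin K) ∧
    MatrixConvex.ofPoint '' K.extremePoints ℝ = MatrixConvex.AEP (MatrixConvex.Wmin K) ∧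
    MatrixConvex.ofPoint '' MatrixConvex.isolatedExtremePoints K =
      MatrixConvex.crucialMEP (MatrixConvex.Wmin K) := by
  have h1 : MatrixConvex.MEP (MatrixConvex.Wmin K) ⊆ MatrixConvex.ofPoint '' K.extremePoints ℝ :=
    MatrixConvex.MEP_Wmin_subset hK
  have h2 : MatrixConvex.AEP (MatrixConvex.Wmin K) ⊆ MatrixConvex.MEP (MatrixConvex.Wmin K) :=
    MatrixConvex.AEP_subset_MEP _
  have h3 : MatrixConvex.ofPoint '' K.extremePoints ℝ ⊆ MatrixConvex.AEP (MatrixConvex.Wmin K) := by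
    rintro _ ⟨x, hx, rfl⟩
    exact MatrixConvex.ofPoint_mem_AEP hK hconv hx
  have hMEP := Set.Subset.antisymm (h3.trans h2) h1
  exact ⟨hMEP, Set.Subset.antisymm h3 (h2.trans h1),
    (MatrixConvex.crucialMEP_Wmin hK hconv hMEP.symm).symm⟩
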